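/- **Theorem (Discrete Component Identification).** *Setting.* A latent model for observations $\mathbf x=(x_1,\dots,x_n)$, $x_j\in\mathbb R^{p_j}$, consists of: finitely many discrete variables $\mathbf d=(d_1,\dots,d_{n_d})$ and $\mathbf z=(z_1,\dots,z_{n_z})$, each with finitely many, at least two, possible states (we write $\Omega^{(d)}=\prod_i\Omega^{(d)}_i$ for the set of joint states of $\mathbf d$); a DAG $\mathcal G$ on these variables, all of whose leaves are among the $d_i$, with respect to which the law of $(\mathbf d,\mathbf z)$ is Markov; a continuous variable $\mathbf c\in\mathbb R^{n_c}$ with support $\mathcal C$, which has full support $\mathcal C$ conditionally on every state of $\mathbf d$ of positive probability (as is the case when $\mathbf c$ is independent of $\mathbf d$); and a function $g$ with $\mathbf x=g(\mathbf d,\mathbf c)$. Its bipartite graph $\Gamma$ has an edge $d_i\to x_j$ iff the component $g_j(\mathbf d,\mathbf c)$, $\mathbf c\in\mathcal C$, depends on the argument $d_i$. $\mathrm{Pa}$ and $\mathrm{Ch}_\Gamma$ denote parents and observed children in $\mathcal G\cup\Gamma$ (with $\mathbf c$ not a vertex). Let $(\mathbf d,\mathbf z,\mathbf c,g,\mathcal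 G,\Gamma)$ be the true model and $(\hat{\mathbf d},\hat{\mathbf z},\hat{\mathbf c},\hat g,\hat{\mathcal G},\hat\Gamma)$ an estimated model (with its own numbers of variables, states and dimensions) producing the same law of the observations. Let both take values in a common data space $\mathcal X\subset\prod_j\mathbb R^{p_j}$, and assume of both models: (a) $\mathcal C$ is closed and connected; (b) $g:\Omega^{(d)}\times\mathcal C\to\mathcal X$ is injective, and for each fixed $k\in\Omega^{(d)}$, $g(k,\cdot)$ is continuous on $\mathcal C$ and has a continuous inverse on the data space, i.e. there is a continuous $r_k:\mathcal X\to\mathbb R^{n_c}$ with $r_k(g(k,c))=c$ for all $c\in\mathcal C$. *Part 1.* The estimated discrete variable is an invertible function of the true one: there is a bijection $h$ from the states of $\mathbf d$ of positive probability to the states of $\hat{\mathbf d}$ of positive probability such that for every such state $k$ and every $c\in\mathcal C$, the discrete part of $\hat g^{-1}(g(k,c))$ exists and equals $h(k)$; that is, $\hat{\mathbf d}=h(\mathbf d)$. *Part 2.* Suppose moreover that both models satisfy: (c) the conditional law of each $x_j$ given $(\mathbf d,\mathbf z)$ depends only on $\mathrm{Pa}(x_j)$ (as is the case when $\mathbf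 c$ is independent of $(\mathbf d,\mathbf z)$); (d) [non-degeneracy] all joint states of $(\mathbf d,\mathbf z)$ have positive probability, and for every variable $v$ among the $d_i,z_i,x_j$, the conditional laws of $v$ given $\mathrm{Pa}(v)=k_1$ and given $\mathrm{Pa}(v)=k_2$ differ whenever $k_1\ne k_2$; (e) [no twins] distinct variables among the $d_i,z_i$ have distinct sets of neighbours in $\mathcal G\cup\Gamma$; (f) [non-subset observed children] $\mathrm{Ch}_\Gamma(d_i)\not\subseteq\mathrm{Ch}_\Gamma(d_{i'})$ for all $i\neq i'$. Then $\hat n_d=n_d$, and there are a bijection $\pi$ from the indices of $\hat{\mathbf d}$ to those of $\mathbf d$ and bijections $h_i:\Omega^{(d)}_{\pi(i)}\to\hat\Omega^{(d)}_i$ such that $\hat d_i=h_i(d_{\pi(i)})$ for all $i$ (that is, $h(k)_i=h_i(k_{\pi(i)})$), and $\hat d_i\to x_j$ is an edge of $\hat\Gamma$ iff $d_{\pi(i)}\to x_j$ is an edge of $\Gamma$. (No maximality condition on the latent graph is needed.) -/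

import Mathlib

open MeasureTheory

/-- The space of observations `x = (x₁, …, xₙ)`; the component `x_j` is a vector in `ℝ^(p j)`. -/
abbrev Obs {n : ℕ} (p : Fin n → ℕ) : Type :=
  (j : Fin n) → EuclideanSpace ℝ (Fin (p j))

section Graph

variable {V : Type}

/-- Parents of `v` in the directed graph `E`. -/
def parents (E : V → V → Prop) (v : V) : Set V := {w | E w v}

/-- Non-descendants of `v` (other than `v`) in the directed graph `E`. -/
def nonDescendants (E : V → V → Prop) (v : V) : Set V :=
  {w | w ≠ v ∧ ¬ Relation.TransGen E v w}

/-- The event that the discrete latent variables indexed by `A` take the values prescribed by `k`;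
a sample is a pair (state of all discrete latent variables, value of the continuous one). -/
def agreeOn {S : V → Type} {W : Type} (A : Set V) (k : (v : V) → S v) :
    Set (((v : V) → S v) × W) :=
  {ω | ∀ v ∈ A, ω.1 v = k v}

end Graph

/-- A generating process `x = g(d, c)` together with a discrete hierarchical model over the
discrete latent variables `d` (indexed by `Sum.inl`) and `z` (indexed by `Sum.inr`). -/
structure LatentModel {n : ℕ} (p : Fin n → ℕ) where
  /-- number of discrete variables `d` adjacent to the observations -/
  nd : ℕ
  /-- number of higher-level discrete variables `z` -/
  nz : ℕ
  /-- dimension of the continuous latent variable `c` -/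
  nc : ℕ
  /-- number of states of each discrete latent variable -/
  card : Fin nd ⊕ Fin nz → ℕ
  two_le_card : ∀ v, 2 ≤ card v
  /-- directed edges of the graph over the discrete latent variables -/
  Edge : Fin nd ⊕ Fin nz → Fin nd ⊕ Fin nz → Prop
  acyclic : ∀ v, ¬ Relation.TransGen Edge v v
  /-- all leaves of the graph are among the variables `d` -/
  leaf : ∀ v, (∀ w, ¬ Edge v w) → ∃ i, v = Sum.inl i
  /-- joint law of `((d, z), c)` -/
  law : Measure (((v : Fin nd ⊕ Fin nz) → Fin (card v)) × EuclideanSpace ℝ (Fin nc))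
  prob : IsProbabilityMeasure law
  /-- local Markov property of `(d, z)`: each variable is independent of its non-descendants
  given its parents (stated without division) -/
  markov : ∀ v k,
    law (agreeOn (insert v (nonDescendants Edge v)) k) * law (agreeOn (parents Edge v) k) =
      law (agreeOn (insert v (parents Edge v)) k) * law (agreeOn (nonDescendants Edge v) k)
  /-- the continuous support -/
  C : Set (EuclideanSpace ℝ (Fin nc))
  mem_C : ∀ᵐ ω ∂law, ω.2 ∈ C
  /-- in every discrete state `d = k` that occurs, `c` charges every nonempty relatively open
  subset of `C` -/
  full_C : ∀ k : (i : Fin nd) → Fin (card (Sum.inl i)),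
    0 < law {ω | ∀ i, ω.1 (Sum.inl i) = k i} →
    ∀ U : Set (EuclideanSpace ℝ (Fin nc)), IsOpen U → (U ∩ C).Nonempty →
      0 < law {ω | (∀ i, ω.1 (Sum.inl i) = k i) ∧ ω.2 ∈ U}
  /-- the generating function; only its values for `c ∈ C` matter -/
  g : ((i : Fin nd) → Fin (card (Sum.inl i))) → EuclideanSpace ℝ (Fin nc) → Obs p

namespace LatentModel

variable {n : ℕ} {p : Fin n → ℕ}

/-- Joint states of all discrete latent variables `(d, z)`. -/
abbrev State (M : LatentModel p) : Type := (v : Fin M.nd ⊕ Fin M.nz) → Fin (M.card v)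

/-- Joint states of the discrete variables `d`. -/
abbrev DState (M : LatentModel p) : Type := (i : Fin M.nd) → Fin (M.card (Sum.inl i))

/-- Sample space of the latent variables. -/
abbrev Sample (M : LatentModel p) : Type := M.State × EuclideanSpace ℝ (Fin M.nc)

/-- The random variable `d`. -/
def d (M : LatentModel p) (ω : M.Sample) : M.DState := fun i => ω.1 (Sum.inl i)

/-- The random variable `x = g(d, c)`. -/
def x (M : LatentModel p) (ω : M.Sample) : Obs p := M.g (M.d ω) ω.2

/-- The observed law `p(x)`. -/
noncomputable def obsLaw (M : LatentModel p) : Measure (Obs p) := M.law.map M.x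

/-- States of `d` of positive probability (the support of `d`). -/
def DSupport (M : LatentModel p) : Set M.DState := {k | 0 < M.law {ω | M.d ω = k}}

/-- `k` is the discrete part of `g⁻¹(y)`. (Unique when `g` is injective.) -/
def Decodes (M : LatentModel p) (y : Obs p) (k : M.DState) : Prop := ∃ c ∈ M.C, M.g k c = y

/-- The bipartite graph resulting from `g`: `d_i → x_j` is an edge iff the component `g_j` depends
on the argument `d_i`. -/
def Gam (M : LatentModel p) (i : Fin M.nd) (j : Fin n) : Prop :=
  ∃ k k' : M.DState, (∀ i', i' ≠ i → k i' = k' i') ∧ ∃ c ∈ M.C, M.g k c j ≠ M.g k' c j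

/-- Observed children of `d_i`. -/
def obsChildren (M : LatentModel p) (i : Fin M.nd) : Set (Fin n) := {j | M.Gam i j}

/-- Parents of `x_j`, as a set of latent discrete variables. -/
def obsParents (M : LatentModel p) (j : Fin n) : Set (Fin M.nd ⊕ Fin M.nz) :=
  {v | ∃ i, v = Sum.inl i ∧ M.Gam i j}

/-- Conditional law of `x_j` given an event `A` on the latent variables. -/
noncomputable def condLaw (M : LatentModel p) (j : Fin n) (A : Set M.Sample) :
    Measure (EuclideanSpace ℝ (Fin (p j))) :=
  (ProbabilityTheory.cond M.law A).map (fun ω => M.x ω j)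

/-- The continuous support is closed and connected. -/
def ConnectedSupport (M : LatentModel p) : Prop := IsClosed M.C ∧ IsConnected M.C

/-- Invertibility and continuity, relative to the data space `X`: `g` maps into `X` and is
one-to-one, each `g(k, ·)` is continuous, and so is its inverse, as a map on the data space `X`
(which is what makes closedness of `C` pass to its images in `X`). -/
structure InvertibleContinuous (M : LatentModel p) (X : Set (Obs p)) : Prop where
  mapsTo : ∀ k, ∀ c ∈ M.C, M.g k c ∈ X
  inj : ∀ k k', ∀ c ∈ M.C, ∀ c' ∈ M.C, M.g k c = M.g k' c' → k = k' ∧ c = c'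
  cont : ∀ k, ContinuousOn (M.g k) M.C
  cont_inv : ∀ k, ∃ r : Obs p → EuclideanSpace ℝ (Fin M.nc),
    ContinuousOn r X ∧ ∀ c ∈ M.C, r (M.g k c) = c

/-- Markov property of the observed variables: given all discrete latent variables, the law of
`x_j` depends only on its parents. (Automatic if `c` is independent of `(d, z)`. The components of
`x` need not be conditionally independent of each other.) -/
def ObservedMarkov (M : LatentModel p) : Prop :=
  ∀ (j : Fin n) (k : M.State), 0 < M.law (agreeOn Set.univ k) →
    M.condLaw j (agreeOn Set.univ k) = M.condLaw j (agreeOn (M.obsParents j) k)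

/-- Non-degeneracy: all joint states have positive probability, and every variable (latent or
observed) has different conditional laws given different states of its parents. -/
structure Nondegenerate (M : LatentModel p) : Prop where
  pos : ∀ k : M.State, 0 < M.law (agreeOn Set.univ k)
  latent : ∀ v (k k' : M.State), (∃ u ∈ parents M.Edge v, k u ≠ k' u) →
    ∃ a : Fin (M.card v),
      ProbabilityTheory.cond M.law (agreeOn (parents M.Edge v) k) {ω | ω.1 v = a} ≠
        ProbabilityTheory.cond M.law (agreeOn (parents M.Edge v) k') {ω | ω.1 v = a}
  observed : ∀ (j : Fin n) (k k' : M.State), (∃ u ∈ M.obsParents j, k u ≠ k' u) →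
    M.condLaw j (agreeOn (M.obsParents j) k) ≠ M.condLaw j (agreeOn (M.obsParents j) k')

/-- Neighbours of a latent variable in the whole graph, i.e. parents and children among the latent
variables, and children among the observed ones. -/
def neighbors (M : LatentModel p) (v : Fin M.nd ⊕ Fin M.nz) :
    Set ((Fin M.nd ⊕ Fin M.nz) ⊕ Fin n) :=
  {w | (∃ u, w = Sum.inl u ∧ (M.Edge u v ∨ M.Edge v u)) ∨ ∃ j, w = Sum.inr j ∧ v ∈ M.obsParents j}

/-- Distinct latent variables have distinct neighbours. -/
def NoTwins (M : LatentModel p) : Prop := ∀ v w, v ≠ w → M.neighbors v ≠ M.neighbors w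

/-- The observed children of one `d_i` are never contained in those of another. -/
def NonSubsetChildren (M : LatentModel p) : Prop :=
  ∀ i i', i ≠ i' → ¬ M.obsChildren i ⊆ M.obsChildren i'

/-- The further conditions imposed for component-wise identification. -/
structure ComponentConditions (M : LatentModel p) : Prop where
  observedMarkov : M.ObservedMarkov
  nondegenerate : M.Nondegenerate
  noTwins : M.NoTwins
  nonSubset : M.NonSubsetChildren

end LatentModel

/-! Inside the data space, the topological support of the observed law is a finite disjoint union of
the pieces `g k '' C`, one per state of positive probability. Each piece is connected and relatively
closed, so the pieces are the connected components of a set fixed by the law alone, and both models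
have the same ones (`exists_equiv_image_eq`). For Part 2, conditioning the observed law on a piece
gives a law of `x_j` that is equal for two states iff they agree on the parents of `x_j`
(`agree_iff`). So `h` preserves agreement on the parents of every `x_j`, and combinatorics with the
antichain of children sets makes it act coordinatewise (`PreservesAgreement.componentwise`). -/

/-! ### Bijections of finite products: combinatorics -/

section Product

variable {I I' J : Type} {α : I → Type} {β : I' → Type}

/-- `h` identifies, for every `j`, the states agreeing on the parents of `j` on both sides. -/
def PreservesAgreement (R : I → J → Prop) (R' : I' → J → Prop)
    (h : ((i : I) → α i) ≃ ((i : I') → β i)) : Prop :=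
  ∀ j k l, (∀ i, R i j → k i = l i) ↔ (∀ i, R' i j → h k i = h l i)

theorem PreservesAgreement.symm {R : I → J → Prop} {R' : I' → J → Prop}
    {h : ((i : I) → α i) ≃ ((i : I') → β i)} (H : PreservesAgreement R R' h) :
    PreservesAgreement R' R h.symm := by
  intro j k l
  simpa using (H j (h.symm k) (h.symm l)).symm

/-- Changing coordinate `i` alone must change some output coordinate `i'`. A child `j` of `i'`
outside the children of `i` would not see the change, forcing output `i'` to stay fixed. -/
theorem PreservesAgreement.exists_subset [∀ i, Nontrivial (α i)]
    {R : I → J → Prop} {R' : I' → J → Prop} {h : ((i : I) → α i) ≃ ((i : I') → β i)}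
    (H : PreservesAgreement R R' h) (i : I) : ∃ i', ∀ j, R' i' j → R i j := by
  classical
  let k : (i : I) → α i := fun i => Classical.arbitrary (α i)
  obtain ⟨a, ha⟩ := exists_ne (k i)
  have hne : h k ≠ h (Function.update k i a) := by
    intro e
    have := congrFun (h.injective e) i
    simp only [Function.update_self] at this
    exact ha this.symm
  obtain ⟨i', hi'⟩ := Function.ne_iff.1 hne
  refine ⟨i', fun j hj => ?_⟩
  by_contra hR
  refine hi' ((H j k (Function.update k i a)).1 (fun i₀ h₀ => ?_) i' hj)
  rw [Function.update_of_ne]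
  rintro rfl
  exact hR h₀

/-- Going across and back gives `i₁` whose children lie among those of `i`; the antichain condition
forces `i₁ = i`, so both inclusions are equalities. -/
theorem PreservesAgreement.exists_same_children [∀ i, Nontrivial (α i)] [∀ i, Nontrivial (β i)]
    {R : I → J → Prop} {R' : I' → J → Prop} {h : ((i : I) → α i) ≃ ((i : I') → β i)}
    (H : PreservesAgreement R R' h)
    (hR : ∀ i₁ i₂, (∀ j, R i₁ j → R i₂ j) → i₁ = i₂) (i : I) :
    ∃ i', ∀ j, R' i' j ↔ R i j := by
  obtain ⟨i', hi'⟩ := H.exists_subset i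
  obtain ⟨i₁, hi₁⟩ := H.symm.exists_subset i'
  obtain rfl := hR i₁ i fun j hj => hi' j (hi₁ j hj)
  exact ⟨i', fun j => ⟨hi' j, hi₁ j⟩⟩

theorem PreservesAgreement.apply_eq [Finite I] {R : I → J → Prop} {R' : I' → J → Prop}
    {h : ((i : I) → α i) ≃ ((i : I') → β i)} (H : PreservesAgreement R R' h)
    (hR' : ∀ i₁ i₂, (∀ j, R' i₁ j → R' i₂ j) → i₁ = i₂)
    (π : I' ≃ I) (hπ : ∀ i j, R' i j ↔ R (π i) j) (i : I') {k l : (i : I) → α i}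
    (hkl : k (π i) = l (π i)) : h k i = h l i := by
  classical
  cases nonempty_fintype I
  -- Some child `j` of `i` is not a child of `a`, so a change at `a` is invisible to `j` and leaves
  -- output `i` fixed.
  have single : ∀ a : I, a ≠ π i → ∀ k l : (i : I) → α i, (∀ b, b ≠ a → k b = l b) →
      h k i = h l i := by
    intro a ha k l hkl
    have : ¬ ∀ j, R' i j → R' (π.symm a) j := fun hs =>
      ha (by rw [hR' _ _ hs, Equiv.apply_symm_apply])
    push Not at this
    obtain ⟨j, hj, hj'⟩ := this
    rw [hπ, Equiv.apply_symm_apply] at hj'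
    exact (H j k l).1 (fun b hb => hkl b (by rintro rfl; exact hj' hb)) i hj
  -- `S` contains all coordinates where `k` and `l` may differ; they are overwritten one at a time.
  have chain : ∀ (S : Finset I) (k : (i : I) → α i), π i ∉ S → (∀ b, b ∉ S → k b = l b) →
      h k i = h l i := by
    intro S
    induction S using Finset.induction_on with
    | empty =>
      intro k _ hk
      rw [show k = l from funext fun b => hk b (by simp)]
    | insert a S ha ih =>
      intro k hS hk
      rw [Finset.mem_insert, not_or] at hS
      rw [single a (Ne.symm hS.1) k (Function.update k a (l a))
        (fun b hb => (Function.update_of_ne hb _ _).symm)]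
      refine ih _ hS.2 fun b hb => ?_
      by_cases hba : b = a
      · subst hba; simp
      · rw [Function.update_of_ne hba]
        exact hk b (by simp [hba, hb])
  refine chain (Finset.univ.erase (π i)) k (by simp) fun b hb => ?_
  have : b = π i := by simpa using hb
  rw [this, hkl]

/-- A bijection between products preserving agreement on the parents of each `j` acts
componentwise, if no set of children contains another one. -/
theorem PreservesAgreement.componentwise [Finite I] [Finite I']
    [∀ i, Nontrivial (α i)] [∀ i, Nontrivial (β i)]
    {R : I → J → Prop} {R' : I' → J → Prop} {h : ((i : I) → α i) ≃ ((i : I') → β i)}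
    (H : PreservesAgreement R R' h)
    (hR : ∀ i₁ i₂, (∀ j, R i₁ j → R i₂ j) → i₁ = i₂)
    (hR' : ∀ i₁ i₂, (∀ j, R' i₁ j → R' i₂ j) → i₁ = i₂) :
    ∃ (π : I' ≃ I) (e : (i : I') → α (π i) ≃ β i),
      (∀ k i, h k i = e i (k (π i))) ∧ ∀ i j, R' i j ↔ R (π i) j := by
  classical
  choose f hf using H.exists_same_children hR
  choose f' hf' using H.symm.exists_same_children hR'
  let π : I' ≃ I :=
    { toFun := f'
      invFun := f
      left_inv := fun i => hR' _ _ fun j hj => (hf' i j).1 ((hf _ j).1 hj)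
      right_inv := fun i => hR _ _ fun j hj => (hf i j).1 ((hf' _ j).1 hj) }
  have hπ : ∀ i j, R' i j ↔ R (π i) j := fun i j => (hf' i j).symm
  have fwd : ∀ i {k l : (i : I) → α i}, k (π i) = l (π i) → h k i = h l i :=
    fun i _ _ => H.apply_eq hR' π hπ i
  have bwd : ∀ i {k l : (i : I) → α i}, h k i = h l i → k (π i) = l (π i) := by
    intro i k l hkl
    have := H.symm.apply_eq hR π.symm (fun a j => by rw [hπ, Equiv.apply_symm_apply]) (π i)
      (k := h k) (l := h l) (by rw [Equiv.symm_apply_apply]; exact hkl)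
    simpa using this
  let k₀ : (i : I) → α i := fun i => Classical.arbitrary (α i)
  have hbij : ∀ i, Function.Bijective
      (fun a : α (π i) => h (Function.update k₀ (π i) a) i) := by
    refine fun i => ⟨fun a b hab => by simpa using bwd i hab, fun b => ?_⟩
    refine ⟨h.symm (Function.update (h k₀) i b) (π i), ?_⟩
    have := fwd i (k := Function.update k₀ (π i) (h.symm (Function.update (h k₀) i b) (π i)))
      (l := h.symm (Function.update (h k₀) i b)) (by simp)
    simpa using this
  exact ⟨π, fun i => Equiv.ofBijective _ (hbij i), fun k i => fwd i (by simp), hπ⟩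

end Product

/-! ### Uniqueness of decompositions into connected relatively closed sets -/

section ClosedFamily

variable {Y ι ι' : Type*} [TopologicalSpace Y]

/-- A preconnected set covered by finitely many disjoint relatively closed sets lies in one. -/
theorem IsPreconnected.exists_subset_of_closure_inter_subset [Finite ι] {X S : Set Y}
    {A : ι → Set Y} (hA : ∀ i, closure (A i) ∩ X ⊆ A i) (hd : Pairwise (Function.onFun Disjoint A))
    (hS : IsPreconnected S) (hne : S.Nonempty) (hSX : S ⊆ X) (hSA : S ⊆ ⋃ i, A i) :
    ∃ i, S ⊆ A i := by
  obtain ⟨y, hy⟩ := hne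
  obtain ⟨i, hi⟩ := Set.mem_iUnion.1 (hSA hy)
  refine ⟨i, ?_⟩
  -- Finiteness makes the union of the other closures closed; within `X` taking closures adds
  -- nothing, so the two closed sets are disjoint on `S`.
  have key := isPreconnected_iff_subset_of_disjoint_closed.1 hS (closure (A i))
    (⋃ b : {b // b ≠ i}, closure (A b)) isClosed_closure
    (isClosed_iUnion_of_finite fun _ => isClosed_closure) ?_ ?_
  · rcases key with h | h
    · exact fun z hz => hA i ⟨h hz, hSX hz⟩
    · obtain ⟨⟨b, hb⟩, hyb⟩ := Set.mem_iUnion.1 (h hy)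
      exact (Set.disjoint_left.1 (hd hb) (hA b ⟨hyb, hSX hy⟩) hi).elim
  · intro z hz
    obtain ⟨b, hb⟩ := Set.mem_iUnion.1 (hSA hz)
    by_cases hbi : b = i
    · subst hbi; exact Or.inl (subset_closure hb)
    · exact Or.inr (Set.mem_iUnion.2 ⟨⟨b, hbi⟩, subset_closure hb⟩)
  · refine Set.eq_empty_of_forall_notMem fun z hz => ?_
    obtain ⟨hzS, hzi, hzu⟩ := hz
    obtain ⟨⟨b, hb⟩, hzb⟩ := Set.mem_iUnion.1 hzu
    exact Set.disjoint_left.1 (hd hb) (hA b ⟨hzb, hSX hzS⟩) (hA i ⟨hzi, hSX hzS⟩)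

/-- Two finite families of disjoint connected relatively closed sets with the same union agree up
to reindexing. -/
theorem exists_equiv_of_iUnion_eq [Finite ι] [Finite ι'] {X : Set Y}
    {A : ι → Set Y} {B : ι' → Set Y}
    (hA : ∀ i, closure (A i) ∩ X ⊆ A i) (hdA : Pairwise (Function.onFun Disjoint A))
    (hcA : ∀ i, IsConnected (A i)) (hXA : ∀ i, A i ⊆ X)
    (hB : ∀ i, closure (B i) ∩ X ⊆ B i) (hdB : Pairwise (Function.onFun Disjoint B))
    (hcB : ∀ i, IsConnected (B i)) (hXB : ∀ i, B i ⊆ X)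
    (hU : ⋃ i, A i = ⋃ i, B i) : ∃ e : ι ≃ ι', ∀ i, B (e i) = A i := by
  have h1 : ∀ i, ∃ i', A i ⊆ B i' := fun i =>
    (hcA i).isPreconnected.exists_subset_of_closure_inter_subset hB hdB (hcA i).nonempty (hXA i)
      (hU ▸ Set.subset_iUnion A i)
  have h2 : ∀ i, ∃ i', B i ⊆ A i' := fun i =>
    (hcB i).isPreconnected.exists_subset_of_closure_inter_subset hA hdA (hcB i).nonempty (hXB i)
      (hU ▸ Set.subset_iUnion B i)
  choose f hf using h1
  choose f' hf' using h2
  have e1 : ∀ i, f' (f i) = i := fun i => by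
    by_contra h
    obtain ⟨z, hz⟩ := (hcA i).nonempty
    exact Set.disjoint_left.1 (hdA h) (hf' _ (hf _ hz)) hz
  have e2 : ∀ i, f (f' i) = i := fun i => by
    by_contra h
    obtain ⟨z, hz⟩ := (hcB i).nonempty
    exact Set.disjoint_left.1 (hdB h) (hf _ (hf' _ hz)) hz
  refine ⟨⟨f, f', e1, e2⟩, fun i => Set.Subset.antisymm ?_ (hf i)⟩
  simpa only [Equiv.coe_fn_mk, e1] using hf' (f i)

end ClosedFamily

/-! ### Images of the discrete states and the support of the observed law -/

namespace LatentModel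

variable {n : ℕ} {p : Fin n → ℕ} {X : Set (Obs p)} {M : LatentModel p}

/-- The observations produced in the discrete state `k`. -/
def image (M : LatentModel p) (k : M.DState) : Set (Obs p) := M.g k '' M.C

theorem InvertibleContinuous.image_subset (hg : M.InvertibleContinuous X) (k : M.DState) :
    M.image k ⊆ X := by
  rintro _ ⟨c, hc, rfl⟩
  exact hg.mapsTo k c hc

theorem InvertibleContinuous.pairwise_disjoint (hg : M.InvertibleContinuous X) :
    Pairwise (Function.onFun Disjoint M.image) := by
  intro k k' hk
  refine Set.disjoint_left.2 ?_
  rintro _ ⟨c, hc, rfl⟩ ⟨c', hc', h⟩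
  exact hk (hg.inj _ _ _ hc' _ hc h).1.symm

theorem InvertibleContinuous.isConnected_image (hg : M.InvertibleContinuous X)
    (hC : M.ConnectedSupport) (k : M.DState) : IsConnected (M.image k) :=
  hC.2.image _ (hg.cont k)

/-- The inverse `r` is continuous at a limit point `y ∈ X`, so `r y ∈ C` as `C` is closed; passing
to the limit in `g k (r z) = z` gives `g k (r y) = y`. -/
theorem InvertibleContinuous.closure_image_inter_subset (hg : M.InvertibleContinuous X)
    (hC : M.ConnectedSupport) (k : M.DState) : closure (M.image k) ∩ X ⊆ M.image k := by
  rintro y ⟨hy, hyX⟩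
  obtain ⟨r, hr, hrg⟩ := hg.cont_inv k
  have hmem : Filter.NeBot (nhdsWithin y (M.image k)) := mem_closure_iff_nhdsWithin_neBot.1 hy
  have hlim : Filter.Tendsto r (nhdsWithin y (M.image k)) (nhds (r y)) :=
    (hr y hyX).mono_left (nhdsWithin_mono _ (hg.image_subset k))
  have hrC : ∀ᶠ z in nhdsWithin y (M.image k), r z ∈ M.C := by
    filter_upwards [self_mem_nhdsWithin]
    rintro _ ⟨c, hc, rfl⟩
    rwa [hrg c hc]
  have hry : r y ∈ M.C := hC.1.mem_of_tendsto hlim hrC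
  have hgr : Filter.Tendsto (fun z => M.g k (r z)) (nhdsWithin y (M.image k))
      (nhds (M.g k (r y))) :=
    (hg.cont k _ hry).tendsto.comp (tendsto_nhdsWithin_iff.2 ⟨hlim, hrC⟩)
  have hid : Filter.Tendsto (fun z => M.g k (r z)) (nhdsWithin y (M.image k)) (nhds y) := by
    refine (tendsto_nhdsWithin_of_tendsto_nhds Filter.tendsto_id).congr' ?_
    filter_upwards [self_mem_nhdsWithin]
    rintro _ ⟨c, hc, rfl⟩
    simp only [id, hrg c hc]
  exact ⟨r y, hry, tendsto_nhds_unique hgr hid⟩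

theorem InvertibleContinuous.measurableSet_image (hg : M.InvertibleContinuous X)
    (hC : M.ConnectedSupport) (k : M.DState) : MeasurableSet (M.image k) :=
  hC.1.measurableSet.image_of_continuousOn_injOn (hg.cont k)
    fun c hc c' hc' h => (hg.inj k k c hc c' hc' h).2

theorem measurable_d (M : LatentModel p) : Measurable M.d :=
  measurable_pi_iff.2 fun i => (measurable_pi_apply (Sum.inl i)).comp measurable_fst

theorem measurableSet_d_eq (M : LatentModel p) (k : M.DState) :
    MeasurableSet {ω | M.d ω = k} :=
  M.measurable_d (measurableSet_singleton k)

theorem InvertibleContinuous.aemeasurable_x (hg : M.InvertibleContinuous X)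
    (hC : M.ConnectedSupport) : AEMeasurable M.x M.law := by
  classical
  -- `g` is unconstrained off `C`, a null event for `c`, so it is replaced there by `0`.
  let f : M.DState → EuclideanSpace ℝ (Fin M.nc) → Obs p := fun k => M.C.piecewise (M.g k) 0
  have hf : ∀ k, Measurable (f k) := fun k =>
    (hg.cont k).measurable_piecewise continuousOn_const hC.1.measurableSet
  have hf' : Measurable fun q : M.DState × EuclideanSpace ℝ (Fin M.nc) => f q.1 q.2 :=
    measurable_from_prod_countable_right hf
  refine ⟨fun ω => f (M.d ω) ω.2, hf'.comp (M.measurable_d.prodMk measurable_snd), ?_⟩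
  filter_upwards [M.mem_C] with ω hω
  simp only [f, Set.piecewise_eq_of_mem _ _ _ hω, x]

theorem InvertibleContinuous.obsLaw_apply (hg : M.InvertibleContinuous X)
    (hC : M.ConnectedSupport) {B : Set (Obs p)} (hB : MeasurableSet B) :
    M.obsLaw B = M.law (M.x ⁻¹' B) :=
  Measure.map_apply_of_aemeasurable (hg.aemeasurable_x hC) hB

/-- By injectivity, observing a point of the piece of `k` is almost surely the event `d = k`. -/
theorem InvertibleContinuous.obsLaw_image_inter (hg : M.InvertibleContinuous X)
    (hC : M.ConnectedSupport) (k : M.DState) {B : Set (Obs p)} (hB : MeasurableSet B) :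
    M.obsLaw (M.image k ∩ B) = M.law ({ω | M.d ω = k} ∩ M.x ⁻¹' B) := by
  rw [hg.obsLaw_apply hC ((hg.measurableSet_image hC k).inter hB)]
  refine measure_congr ?_
  filter_upwards [M.mem_C] with ω hω
  refine propext (and_congr_left fun _ => ⟨?_, ?_⟩)
  · rintro ⟨c, hc, h⟩
    exact (hg.inj _ _ c hc ω.2 hω h).1.symm
  · rintro h
    refine ⟨ω.2, hω, ?_⟩
    rw [← (h : M.d ω = k)]
    rfl

theorem ae_d_mem (M : LatentModel p) : ∀ᵐ ω ∂M.law, M.d ω ∈ M.DSupport := by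
  have : ∀ k : M.DState, ∀ᵐ ω ∂M.law, M.d ω = k → k ∈ M.DSupport := by
    intro k
    by_cases hk : k ∈ M.DSupport
    · exact Filter.Eventually.of_forall fun _ _ => hk
    · have h0 : M.law {ω | M.d ω = k} = 0 := by simpa [DSupport] using hk
      filter_upwards [measure_eq_zero_iff_ae_notMem.1 h0] with ω hω h
      exact (hω h).elim
  filter_upwards [ae_all_iff.2 this] with ω hω
  exact hω _ rfl

/-- Within the data space, the topological support of the observed law is the union of the images
of the discrete states that occur. -/
theorem InvertibleContinuous.mem_iUnion_image_iff (hg : M.InvertibleContinuous X)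
    (hC : M.ConnectedSupport) {y : Obs p} (hy : y ∈ X) :
    y ∈ ⋃ k : M.DSupport, M.image k ↔ ∀ U, IsOpen U → y ∈ U → 0 < M.obsLaw U := by
  constructor
  · intro h U hU hyU
    obtain ⟨⟨k, hk⟩, c, hc, rfl⟩ := Set.mem_iUnion.1 h
    obtain ⟨V, hV, hVU⟩ := continuousOn_iff'.1 (hg.cont k) U hU
    have hcV : c ∈ V ∩ M.C := hVU ▸ ⟨hyU, hc⟩
    have hpos : 0 < M.law {ω | (∀ i, ω.1 (Sum.inl i) = k i) ∧ ω.2 ∈ V} := by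
      refine M.full_C k ?_ V hV ⟨c, hcV⟩
      simpa [DSupport, d, funext_iff] using hk
    rw [hg.obsLaw_apply hC hU.measurableSet]
    refine hpos.trans_le (measure_mono_ae ?_)
    filter_upwards [M.mem_C] with ω hω h
    have hd : M.d ω = k := funext h.1
    have : ω.2 ∈ M.g k ⁻¹' U ∩ M.C := hVU ▸ ⟨h.2, hω⟩
    change M.g (M.d ω) ω.2 ∈ U
    rw [hd]
    exact this.1
  · intro h
    by_contra hn
    -- This open set is null for the observed law, and contains `y` if `y` lies in no piece.
    have hU : IsOpen (⋃ k : M.DSupport, closure (M.image k))ᶜ :=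
      (isClosed_iUnion_of_finite fun _ => isClosed_closure).isOpen_compl
    refine (h _ hU fun hy' => hn ?_).ne' ?_
    · obtain ⟨k, hk⟩ := Set.mem_iUnion.1 hy'
      exact Set.mem_iUnion.2 ⟨k, hg.closure_image_inter_subset hC k ⟨hk, hy⟩⟩
    · rw [hg.obsLaw_apply hC hU.measurableSet, measure_eq_zero_iff_ae_notMem]
      filter_upwards [M.mem_C, M.ae_d_mem] with ω hω hd h
      exact h (Set.mem_iUnion.2 ⟨⟨M.d ω, hd⟩, subset_closure ⟨ω.2, hω, rfl⟩⟩)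

theorem exists_equiv_image_eq {M' : LatentModel p}
    (hC : M.ConnectedSupport) (hC' : M'.ConnectedSupport)
    (hg : M.InvertibleContinuous X) (hg' : M'.InvertibleContinuous X)
    (hlaw : M'.obsLaw = M.obsLaw) :
    ∃ h : M.DSupport ≃ M'.DSupport, ∀ k, M'.image (h k).1 = M.image k.1 := by
  refine exists_equiv_of_iUnion_eq (X := X) (A := fun k : M.DSupport => M.image k.1)
    (B := fun k : M'.DSupport => M'.image k.1)
    (fun k => hg.closure_image_inter_subset hC k)
    (hg.pairwise_disjoint.comp_of_injective Subtype.val_injective)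
    (fun k => hg.isConnected_image hC k) (fun k => hg.image_subset k)
    (fun k => hg'.closure_image_inter_subset hC' k)
    (hg'.pairwise_disjoint.comp_of_injective Subtype.val_injective)
    (fun k => hg'.isConnected_image hC' k) (fun k => hg'.image_subset k) ?_
  ext y
  by_cases hy : y ∈ X
  · rw [hg.mem_iUnion_image_iff hC hy, hg'.mem_iUnion_image_iff hC' hy, hlaw]
  · simp only [Set.mem_iUnion]
    exact ⟨fun ⟨k, hk⟩ => (hy (hg.image_subset _ hk)).elim,
      fun ⟨k, hk⟩ => (hy (hg'.image_subset _ hk)).elim⟩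

/-! ### Conditional laws of the observed components -/

theorem agreeOn_univ (s : M.State) :
    (agreeOn Set.univ s : Set M.Sample) = Prod.fst ⁻¹' {s} := by
  ext ω
  simp [agreeOn, funext_iff]

/-- In a discrete state of positive probability, the law of `x_j` is its conditional law given its
parents. -/
theorem ObservedMarkov.law_inter_eq (hM : M.ObservedMarkov) (hx : AEMeasurable M.x M.law)
    (hpos : ∀ k : M.State, 0 < M.law (agreeOn Set.univ k)) (j : Fin n) (s : M.State)
    {B : Set (EuclideanSpace ℝ (Fin (p j)))} (hB : MeasurableSet B) :
    M.law ({ω | M.d ω = fun i => s (Sum.inl i)} ∩ (fun ω => M.x ω j) ⁻¹' B) =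
      M.law {ω | M.d ω = fun i => s (Sum.inl i)} * M.condLaw j (agreeOn (M.obsParents j) s) B := by
  classical
  have := M.prob
  have hms : ∀ t : M.State, MeasurableSet (Prod.fst ⁻¹' {t} : Set M.Sample) :=
    fun t => measurable_fst (measurableSet_singleton t)
  -- `ObservedMarkov` conditions on `(d, z)`, so `z` is summed out. All terms share one conditional
  -- law, since the parents of `x_j` are among the `d_i`.
  let T : Finset M.State := Finset.univ.filter fun t => ∀ i, t (Sum.inl i) = s (Sum.inl i)
  have hdec : {ω | M.d ω = fun i => s (Sum.inl i)} = ⋃ t ∈ T, (Prod.fst ⁻¹' {t} : Set M.Sample) := by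
    ext ω
    simp only [T, Set.mem_iUnion, Set.mem_preimage, Set.mem_singleton_iff, Finset.mem_filter,
      Finset.mem_univ, true_and, exists_prop, Set.mem_ofPred_eq, d, funext_iff]
    exact ⟨fun h => ⟨ω.1, h, fun _ => rfl⟩, fun ⟨t, ht, hω⟩ i => (hω _).trans (ht i)⟩
  have hdisj : (T : Set M.State).PairwiseDisjoint
      fun t => (Prod.fst ⁻¹' {t} : Set M.Sample) := by
    intro t _ t' _ htt'
    exact Disjoint.preimage _ (Set.disjoint_singleton.2 htt')
  have hsum : ∀ D : Set M.Sample, M.law ({ω | M.d ω = fun i => s (Sum.inl i)} ∩ D) =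
      ∑ t ∈ T, M.law (Prod.fst ⁻¹' {t} ∩ D) := by
    intro D
    -- Restricting the measure to `D` avoids needing `D` measurable: `x` is only almost everywhere
    -- measurable.
    have hR := measure_biUnion_finset (μ := M.law.restrict D) hdisj fun t _ => hms t
    rw [← hdec, Measure.restrict_apply (M.measurableSet_d_eq _)] at hR
    rw [hR]
    exact Finset.sum_congr rfl fun t _ => Measure.restrict_apply (hms t)
  have hxj : AEMeasurable (fun ω => M.x ω j) M.law := (measurable_pi_apply j).comp_aemeasurable hx
  have hterm : ∀ t ∈ T, M.law (Prod.fst ⁻¹' {t} ∩ (fun ω => M.x ω j) ⁻¹' B) =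
      M.law (Prod.fst ⁻¹' {t}) * M.condLaw j (agreeOn (M.obsParents j) s) B := by
    intro t ht
    have hagree : (agreeOn (M.obsParents j) t : Set M.Sample) = agreeOn (M.obsParents j) s := by
      ext ω
      refine forall₂_congr fun v hv => ?_
      obtain ⟨i, rfl, -⟩ := hv
      rw [(Finset.mem_filter.1 ht).2 i]
    rw [← hagree, ← hM j t (hpos t), agreeOn_univ, condLaw,
      Measure.map_apply_of_aemeasurable
        (hxj.mono_ac (ProbabilityTheory.cond_absolutelyContinuous)) hB,
      ProbabilityTheory.cond_apply (hms t), ← mul_assoc, ENNReal.mul_inv_cancel, one_mul]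
    · have := hpos t
      rw [agreeOn_univ] at this
      exact this.ne'
    · exact measure_ne_top _ _
  have htot := hsum Set.univ
  simp only [Set.inter_univ] at htot
  rw [hsum, Finset.sum_congr rfl hterm, ← Finset.sum_mul, ← htot]

/-- Extend a state of `d` to a state of all discrete variables. -/
def extend (M : LatentModel p) (k : M.DState) : M.State
  | Sum.inl i => k i
  -- The value is immaterial: no `z` variable is a parent of an `x_j`.
  | Sum.inr i => ⟨0, zero_lt_two.trans_le (M.two_le_card (Sum.inr i))⟩

theorem Nondegenerate.mem_DSupport (hM : M.Nondegenerate) (k : M.DState) : k ∈ M.DSupport := by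
  refine (hM.pos (M.extend k)).trans_le (measure_mono fun ω hω => ?_)
  exact funext fun i => hω (Sum.inl i) trivial

/-- The left side involves only the observed law and a piece, so it can be compared across models.
-/
theorem ComponentConditions.map_cond_obsLaw (hM : M.ComponentConditions)
    (hC : M.ConnectedSupport) (hg : M.InvertibleContinuous X) (j : Fin n) (k : M.DState) :
    (ProbabilityTheory.cond M.obsLaw (M.image k)).map (fun y => y j) =
      M.condLaw j (agreeOn (M.obsParents j) (M.extend k)) := by
  have := M.prob
  ext B hB
  have hmj : Measurable fun y : Obs p => y j := measurable_pi_apply j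
  have hmeas : M.obsLaw (M.image k) = M.law {ω | M.d ω = k} := by
    simpa using hg.obsLaw_image_inter hC k MeasurableSet.univ
  have hmain := hM.observedMarkov.law_inter_eq (hg.aemeasurable_x hC) hM.nondegenerate.pos j
    (M.extend k) hB
  rw [Measure.map_apply hmj hB, ProbabilityTheory.cond_apply (hg.measurableSet_image hC k), hmeas,
    hg.obsLaw_image_inter hC k (hmj hB)]
  change M.law ({ω | M.d ω = k} ∩ _) = M.law {ω | M.d ω = k} * _ at hmain
  change _ * M.law ({ω | M.d ω = k} ∩ (fun ω => M.x ω j) ⁻¹' B) = _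
  rw [hmain, ← mul_assoc, ENNReal.inv_mul_cancel, one_mul]
  · exact (hM.nondegenerate.mem_DSupport k).ne'
  · exact measure_ne_top _ _

/-- Two discrete states agree on the parents of `x_j` iff they give `x_j` the same law. -/
theorem ComponentConditions.agree_iff (hM : M.ComponentConditions)
    (hC : M.ConnectedSupport) (hg : M.InvertibleContinuous X) (j : Fin n) (k l : M.DState) :
    (∀ i, M.Gam i j → k i = l i) ↔
      (ProbabilityTheory.cond M.obsLaw (M.image k)).map (fun y => y j) =
        (ProbabilityTheory.cond M.obsLaw (M.image l)).map (fun y => y j) := by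
  rw [hM.map_cond_obsLaw hC hg, hM.map_cond_obsLaw hC hg]
  constructor
  · intro h
    congr 1
    ext ω
    refine forall₂_congr fun v hv => ?_
    obtain ⟨i, rfl, hi⟩ := hv
    simp only [extend, h i hi]
  · intro h
    by_contra hn
    push Not at hn
    obtain ⟨i, hi, hne⟩ := hn
    exact hM.nondegenerate.observed j (M.extend k) (M.extend l) ⟨Sum.inl i, ⟨i, rfl, hi⟩, hne⟩ h

theorem NonSubsetChildren.eq_of_subset (hM : M.NonSubsetChildren) (i₁ i₂ : Fin M.nd)
    (h : ∀ j, M.Gam i₁ j → M.Gam i₂ j) : i₁ = i₂ := by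
  by_contra hne
  exact hM i₁ i₂ hne h

instance (M : LatentModel p) (v : Fin M.nd ⊕ Fin M.nz) : Nontrivial (Fin (M.card v)) :=
  Fin.nontrivial_iff_two_le.2 (M.two_le_card v)

end LatentModel

/-! ### Assembly of the two parts -/

theorem theorem1 {n : ℕ} (p : Fin n → ℕ) (X : Set (Obs p)) (M M' : LatentModel p)
    (hC : M.ConnectedSupport) (hC' : M'.ConnectedSupport)
    (hg : M.InvertibleContinuous X) (hg' : M'.InvertibleContinuous X)
    (hlaw : M'.obsLaw = M.obsLaw) :
    ∃ h : M.DSupport ≃ M'.DSupport,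
      (∀ k : M.DSupport, ∀ c ∈ M.C, M'.Decodes (M.g k.1 c) (h k).1) ∧
      (M.ComponentConditions → M'.ComponentConditions →
        ∃ (π : Fin M'.nd ≃ Fin M.nd)
          (hcomp : (i : Fin M'.nd) → Fin (M.card (Sum.inl (π i))) ≃ Fin (M'.card (Sum.inl i))),
          (∀ k : M.DSupport, ∀ i, (h k).1 i = hcomp i (k.1 (π i))) ∧
          (∀ i j, M'.Gam i j ↔ M.Gam (π i) j)) := by
  obtain ⟨h, hh⟩ := LatentModel.exists_equiv_image_eq hC hC' hg hg' hlaw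
  refine ⟨h, fun k c hc => ?_, fun hM hM' => ?_⟩
  · have : M.g k.1 c ∈ M'.image (h k).1 := hh k ▸ ⟨c, hc, rfl⟩
    exact this
  -- Every state has positive probability, so `h` is a bijection between the full products.
  · let H : M.DState ≃ M'.DState :=
      (Equiv.subtypeUnivEquiv hM.nondegenerate.mem_DSupport).symm.trans
        (h.trans (Equiv.subtypeUnivEquiv hM'.nondegenerate.mem_DSupport))
    have hH : PreservesAgreement M.Gam M'.Gam H := by
      intro j k l
      have himage : ∀ k : M.DState, M'.image (H k) = M.image k := fun k => hh ⟨k, _⟩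
      rw [hM.agree_iff hC hg, hM'.agree_iff hC' hg', himage, himage, hlaw]
    obtain ⟨π, e, he, hπ⟩ :=
      hH.componentwise hM.nonSubset.eq_of_subset hM'.nonSubset.eq_of_subset
    exact ⟨π, e, fun k i => he k.1 i, hπ⟩
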